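/- Let $X_1,\dots,X_n$ ($n\ge 1$) be independent, non-negative random variables with continuous distributions (no atoms), not necessarily identically distributed, revealed one by one in this order, which is arbitrary and fixed in advance. In the Top-$1$-of-$2$ problem an online algorithm irrevocably accepts at most two of the revealed values; its reward $\mathrm{ALG}$ is the largest accepted value ($0$ if none is accepted). Let $Z=\max_i X_i$. An algorithm is $\rho$-competitive if $\mathbb E[\mathrm{ALG}]\ge\rho\,\mathbb E[Z]$ for every such instance (expectations in $[0,\infty]$). For every $c>0$ there is a threshold $\tau$ with $\Pr[Z\le\tau]=e^{-c}$. (Three thresholds.) Let $c_1=1.51921$, $c_2=0.380251$, $c_3=0.0386845$, and choose any $\tau_1,\tau_2,\tau_3$ with $\Pr[Z\le\tau_i]=e^{-c_i}$. Start with $r=1$. For $i=1,\dots,n$: if $X_i\ge\tau_r$, accept $X_i$ and set $r:=\min\big(\{k\in\{1,2,3\}:\tau_k>X_i\}\cup\{3\}\big)$; stop as soon as two items have been accepted. This algorithm is $\min(C_1,C_2,C_3,C_4)$-competitive, where \begin{align*} C_1&=1-e^{-c_1},\\ C_2&=e^{-c_1-c_2}\Big(e^{c_1}(e^{c_2}-1)-e^{c_2}+2\sqrt{(e^{c_1}-1)(e^{c_2}-1)}+2\Big),\\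 C_3&=e^{-(c_1+c_2+c_3)}\Big(e^{c_2}(e^{c_2}-2)(e^{c_3}-1)+e^{c_1+c_3}+2\sqrt{e^{c_2}(e^{c_2}-1)(e^{c_3}-1)(e^{c_2}+e^{c_1+c_3}-e^{c_2+c_3})}\Big),\\ C_4&=e^{-c_1}c_3-e^{-c_1}+e^{-c_2}+e^{-c_1+c_2-c_3}, \end{align*} and $\min(C_1,C_2,C_3,C_4)\ge 0.781$; in particular it is $0.781$-competitive. (Two thresholds.) Let $c_1>c_2>0$ and choose any $\tau_1,\tau_2$ with $\Pr[Z\le\tau_i]=e^{-c_i}$. The algorithm that accepts the first value $\ge\tau_1$, and then the first later value $\ge\tau_2$, is $\rho$-competitive with $$\rho=\min\Big(1-e^{-c_1},\; e^{-c_1-c_2}\big(e^{c_1}(e^{c_2}-1)+2\sqrt{(e^{c_1}-1)(e^{c_2}-1)}-e^{c_2}+2\big),\; e^{-c_2}+e^{-c_1}c_2\Big),$$ and for $c_1=1.49721$, $c_2=0.364197$ this $\rho$ is at least $0.776$. -/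

import Mathlib

open MeasureTheory ProbabilityTheory

namespace TopOneOfTwo

noncomputable section

/-- State of a Top-1-of-2 threshold algorithm with `m` thresholds: the index `r` of the threshold
currently in force, and the values accepted so far. -/
structure State (m : ℕ) where
  r : Fin m
  accepted : List ℝ

/-- Processing the next value `x`: as long as fewer than two items were accepted, `x` is accepted
iff `x ≥ τ_r`; upon acceptance the index becomes `next r x`. After two acceptances
nothing changes any more. -/
def step {m : ℕ} (τ : Fin m → ℝ) (next : Fin m → ℝ → Fin m) (s : State m) (x : ℝ) : State m :=
  if s.accepted.length < 2 ∧ τ s.r ≤ x then ⟨next s.r x, x :: s.accepted⟩ else s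

/-- Run on the values `x 0, …, x (n-1)` in this order, starting with the first threshold. -/
def run {m n : ℕ} [NeZero m] (τ : Fin m → ℝ) (next : Fin m → ℝ → Fin m) (x : Fin n → ℝ) :
    State m :=
  (List.ofFn x).foldl (step τ next) ⟨0, []⟩

/-- The reward: the highest accepted value (`0` if nothing was accepted). -/
def reward {m : ℕ} (s : State m) : ℝ := s.accepted.foldr max 0

/-- Two-threshold algorithm: the index moves on by one at each acceptance.  (The addition in
`Fin 2` wraps around only at the second acceptance, after which the index is not used.) -/
def alg₂ {n : ℕ} (τ : Fin 2 → ℝ) (x : Fin n → ℝ) : ℝ :=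
  reward (run τ (fun r _ => r + 1) x)

/-- The least element of `{k | τ k > v} ∪ {last index}`, for three thresholds with
indices `0, 1, 2`. -/
def nextIndex (τ : Fin 3 → ℝ) (v : ℝ) : Fin 3 :=
  (insert (2 : Fin 3) (Finset.univ.filter fun k => v < τ k)).min' (Finset.insert_nonempty _ _)

/-- Three-threshold algorithm: upon acceptance of `v` the index becomes `nextIndex τ v`. -/
def alg₃ {n : ℕ} (τ : Fin 3 → ℝ) (x : Fin n → ℝ) : ℝ :=
  reward (run τ (fun _ v => nextIndex τ v) x)

/-- The prophet's value `Z = max (X 0, …, X (n-1))` (used for `n > 0` only). -/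
def prophet {Ω : Type*} {n : ℕ} (X : Fin n → Ω → ℝ) (ω : Ω) : ℝ := ⨆ i, X i ω

/-- Expectation, in `[0, ∞]`, of an almost surely nonnegative random variable. -/
def expect {Ω : Type*} [MeasurableSpace Ω] (P : Measure Ω) (Y : Ω → ℝ) : ENNReal :=
  ∫⁻ ω, ENNReal.ofReal (Y ω) ∂P

/-- Each `τ k` is the `e ^ (-c k)`-quantile of the maximum: `P (Z ≤ τ k) = e ^ (-c k)`. -/
def IsQuantileThresholds {Ω : Type*} [MeasurableSpace Ω] (P : Measure Ω) {n m : ℕ}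
    (X : Fin n → Ω → ℝ) (c : Fin m → ℝ) (τ : Fin m → ℝ) : Prop :=
  ∀ k, P.real {ω | prophet X ω ≤ τ k} = Real.exp (-c k)

/-- The guarantee for two thresholds. -/
def ratio₂ (c₁ c₂ : ℝ) : ℝ :=
  min (1 - Real.exp (-c₁))
    (min (Real.exp (-c₁ - c₂) * (Real.exp c₁ * (Real.exp c₂ - 1)
        + 2 * √((Real.exp c₁ - 1) * (Real.exp c₂ - 1)) - Real.exp c₂ + 2))
      (Real.exp (-c₂) + Real.exp (-c₁) * c₂))

def C₁ (c₁ : ℝ) : ℝ := 1 - Real.exp (-c₁)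

def C₂ (c₁ c₂ : ℝ) : ℝ :=
  Real.exp (-c₁ - c₂) * (Real.exp c₁ * (Real.exp c₂ - 1) - Real.exp c₂
    + 2 * √((Real.exp c₁ - 1) * (Real.exp c₂ - 1)) + 2)

def C₃ (c₁ c₂ c₃ : ℝ) : ℝ :=
  (Real.exp c₂ * (Real.exp c₂ - 2) * (Real.exp c₃ - 1) + Real.exp (c₁ + c₃)
    + 2 * √(Real.exp c₂ * (Real.exp c₂ - 1) * (Real.exp c₃ - 1)
        * (Real.exp c₂ + Real.exp (c₁ + c₃) - Real.exp (c₂ + c₃))))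
    * (Real.cosh (c₁ + c₂ + c₃) - Real.sinh (c₁ + c₂ + c₃))

def C₄ (c₁ c₂ c₃ : ℝ) : ℝ :=
  Real.exp (-c₁) * c₃ - Real.exp (-c₁) + Real.exp (-c₂) + Real.exp (-c₁ + c₂ - c₃)

/-- The guarantee for three thresholds. -/
def ratio₃ (c₁ c₂ c₃ : ℝ) : ℝ :=
  min (min (C₁ c₁) (C₂ c₁ c₂)) (min (C₃ c₁ c₂ c₃) (C₄ c₁ c₂ c₃))

end

end TopOneOfTwo

/-! By the layer-cake formula it is enough to show `P(ALG > t) ≥ ρ P(Z > t)` for every `t ≥ 0`. By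
independence `P(ALG > t)` obeys a recursion along the list of laws (`law_real_hit`), in which item
`i` enters only through `f = P(X_i < τ₁)`, `g = P(X_i < τ₂)`, `k = P(X_i < τ₃)` and `h = P(X_i ≤
t)`. Their products over all items are `F, G, K = e^{-c₁}, e^{-c₂}, e^{-c₃}` (no atoms) and `H = P(Z
≤ t)`. The task is to bound the recursion below in terms of these products alone, that is, to find
the worst order and splitting of the mass.

If `t < τ₁`, the value is `1 - F`, which gives `C₁`. If `τ₁ ≤ t < τ₂`, the worst case puts all mass
of `[τ₁, t]` into an initial item: the bound is `(1 - F/H)(1 - G) + (F/H)(1 - H)`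
(`firstWin_ge_of_low`). If `τ₂ ≤ t < τ₃`, the worst case has one item in `[τ₁, τ₂)`, then one in
`[τ₂, t]`, then the large values: the bound is `(G/H)(1 - H) + (F/G)(1 - G/H)(1 - K)`
(`firstWin_ge_of_mid`). Dividing these two by `1 - H` and minimising over `H` produces the square
roots of `C₂` and `C₃` (`sq_mul_one_sub_le`).

If `t ≥ τ₃`, an item above `t` wins as soon as the algorithm is still open, meaning that at most one
item was accepted and none exceeded `t`. It suffices that before each item the probability of being
open is at least `C₄` times the probability that all earlier values are at most `t`
(`firstWin_ge_of_high`); summing over the items telescopes to `C₄ (1 - H)`. The logarithm in `C₄`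
comes from splitting the mass of `[τ₃, t]` over infinitely many small items.

The two-threshold algorithm is the case `τ₃ = τ₂`, where the third range of `t` is empty. -/

namespace TopOneOfTwo

/-! ### Lower bounds for the winning recursion in terms of products -/

section Recursion

variable {α : Type*}

/-- Probability that the first later item reaching the threshold in force wins, where an item
stays below the threshold with probability `d` and wins with probability `w`. -/
def laterWin (d w : α → ℝ) : List α → ℝ
  | [] => 0
  | a :: l => w a + d a * laterWin d w l

/-- Winning probability of the whole algorithm: an item is skipped with probability `f`, wins
with probability `w`, and is accepted without winning with probabilities `b` and `c`, after which
the winning probabilities on the remaining items are `u` and `v`. -/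
def firstWin (f w b c : α → ℝ) (u v : List α → ℝ) : List α → ℝ
  | [] => 0
  | a :: l => f a * firstWin f w b c u v l + w a + b a * u l + c a * v l

/-- The product of `f` over a list. -/
def listProd (f : α → ℝ) (l : List α) : ℝ := (l.map f).prod

@[simp] lemma listProd_nil (f : α → ℝ) : listProd f [] = 1 := rfl

@[simp] lemma listProd_cons (f : α → ℝ) (a : α) (l : List α) :
    listProd f (a :: l) = f a * listProd f l := by simp [listProd]

lemma listProd_append (f : α → ℝ) (l l' : List α) :
    listProd f (l ++ l') = listProd f l * listProd f l' := by simp [listProd]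

lemma listProd_pos {f : α → ℝ} {l : List α} (hf : ∀ a ∈ l, 0 < f a) : 0 < listProd f l := by
  induction l with
  | nil => simp
  | cons a l ih =>
    rw [listProd_cons]
    exact mul_pos (hf a (by simp)) (ih fun b hb => hf b (by simp [hb]))

lemma listProd_mono {f g : α → ℝ} {l : List α} (hf : ∀ a ∈ l, 0 < f a) (hfg : ∀ a, f a ≤ g a) :
    listProd f l ≤ listProd g l := by
  induction l with
  | nil => simp
  | cons a l ih =>
    rw [listProd_cons, listProd_cons]
    have h := fun b hb => hf b (List.mem_cons_of_mem a hb)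
    exact mul_le_mul (hfg a) (ih h) (listProd_pos h).le ((hf a (by simp)).le.trans (hfg a))

lemma listProd_le_one {f : α → ℝ} {l : List α} (hf0 : ∀ a ∈ l, 0 ≤ f a) (hf1 : ∀ a, f a ≤ 1) :
    listProd f l ≤ 1 := by
  induction l with
  | nil => simp
  | cons a l ih =>
    rw [listProd_cons]
    have h := fun b hb => hf0 b (List.mem_cons_of_mem a hb)
    exact mul_le_one₀ (hf1 a) (List.prod_nonneg (by simpa using h)) (ih h)

/-- Serves levels below the threshold in force: there every acceptance is a win. The next lemma is
the analogue for the first threshold. -/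
lemma laterWin_one_sub (d : α → ℝ) (l : List α) :
    laterWin d (fun a => 1 - d a) l = 1 - listProd d l := by
  induction l with
  | nil => simp [laterWin]
  | cons a l ih => rw [laterWin, ih, listProd_cons]; ring

lemma firstWin_one_sub (f : α → ℝ) (u v : List α → ℝ) (l : List α) :
    firstWin f (fun a => 1 - f a) (fun _ => 0) (fun _ => 0) u v l = 1 - listProd f l := by
  induction l with
  | nil => simp [firstWin]
  | cons a l ih => rw [firstWin, ih, listProd_cons]; ring

/-- The level lies between the first and the second threshold. -/
lemma firstWin_ge_of_low {f h g : α → ℝ} (hfh : ∀ a, f a ≤ h a) (hhg : ∀ a, h a ≤ g a)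
    (v : List α → ℝ) {l : List α} (hf : ∀ a ∈ l, 0 < f a) :
    1 - listProd f l - listProd g l + listProd f l * listProd g l / listProd h l ≤
      firstWin f (fun a => 1 - h a) (fun a => h a - f a) (fun _ => 0)
        (fun l => 1 - listProd g l) v l := by
  induction l with
  | nil => simp [firstWin]
  | cons a l ih =>
    have hl := fun b hb => hf b (List.mem_cons_of_mem a hb)
    have ih := ih hl
    have hfa := hf a (by simp)
    have hF := listProd_pos hl
    have hFH := listProd_mono hl hfh
    have hG := hF.trans_le (listProd_mono hl fun a => (hfh a).trans (hhg a))
    have hH := hF.trans_le hFH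
    have hha := hfa.trans_le (hfh a)
    have hfha := hfh a
    have hhga := hhg a
    simp only [firstWin, listProd_cons]
    generalize firstWin f _ _ _ _ v l = W at *
    generalize listProd f l = F at *
    generalize listProd g l = G at *
    generalize listProd h l = H at *
    generalize f a = x at *
    generalize g a = y at *
    generalize h a = z at *
    have key : x * F * (y * G) / (z * H) = x / z * (F / H) * (y * G) := by field_simp
    have key' : F * G / H = F / H * G := by ring
    rw [key'] at ih
    rw [key]
    have h1 : x / z ≤ 1 := (div_le_one hha).2 hfha
    have h2 : F / H ≤ 1 := (div_le_one hH).2 hFH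
    have h1' : x / z * z = x := by field_simp
    have h3 : 0 ≤ F / H := by positivity
    have h4 : 0 ≤ x / z := by positivity
    have h5 : x / z * (F / H) ≤ 1 := mul_le_one₀ h1 h3 h2
    -- Once the induction hypothesis is inserted, the two sides differ by exactly this product.
    have h6 : 0 ≤ (y - z) * G * (1 - x / z * (F / H)) :=
      mul_nonneg (mul_nonneg (by linarith) hG.le) (by linarith)
    have h7 := mul_le_mul_of_nonneg_left ih hfa.le
    have h8 : x * (F / H * G) = x / z * (F / H) * (z * G) := by
      rw [← h1']; field_simp
    nlinarith

/-- After a first acceptance below the second threshold, with the level above it. -/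
lemma laterWin_ge {g h : α → ℝ} (hgh : ∀ a, g a ≤ h a) (hh1 : ∀ a, h a ≤ 1) {l : List α}
    (hg : ∀ a ∈ l, 0 < g a) :
    listProd g l / listProd h l - listProd g l ≤ laterWin g (fun a => 1 - h a) l := by
  induction l with
  | nil => simp [laterWin]
  | cons a l ih =>
    have hl := fun b hb => hg b (List.mem_cons_of_mem a hb)
    have ih := ih hl
    have hga := hg a (by simp)
    have hG := listProd_pos hl
    have hGH := listProd_mono hl hgh
    have hH := hG.trans_le hGH
    have hha := hga.trans_le (hgh a)
    have hgha := hgh a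
    have hh1a := hh1 a
    simp only [laterWin, listProd_cons]
    generalize laterWin g _ l = W at *
    generalize listProd g l = G at *
    generalize listProd h l = H at *
    generalize g a = y at *
    generalize h a = z at *
    have key : y * G / (z * H) = y / z * (G / H) := by field_simp
    rw [key]
    have h1 : y / z ≤ 1 := (div_le_one hha).2 hgha
    have h2 : G / H ≤ 1 := (div_le_one hH).2 hGH
    have h1' : y / z * z = y := by field_simp
    have h3 : 0 ≤ G / H := by positivity
    have h5 : y / z * (G / H) ≤ 1 := mul_le_one₀ h1 h3 h2
    -- Again the exact difference of the two sides after the induction hypothesis.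
    have h6 : 0 ≤ (1 - z) * (1 - y / z * (G / H)) := mul_nonneg (by linarith) (by linarith)
    have h7 := mul_le_mul_of_nonneg_left ih hga.le
    have h8 : y * (G / H) = y / z * (G / H) * z := by
      rw [← h1']; field_simp
    nlinarith

/-- The level lies between the second and the third threshold. -/
lemma firstWin_ge_of_mid {f g h k : α → ℝ} (hfg : ∀ a, f a ≤ g a) (hgh : ∀ a, g a ≤ h a)
    (hhk : ∀ a, h a ≤ k a) (hk1 : ∀ a, k a ≤ 1) {l : List α} (hf : ∀ a ∈ l, 0 < f a) :
    listProd g l / listProd h l - listProd g l +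
        listProd f l / listProd g l * (1 - listProd g l / listProd h l) * (1 - listProd k l) ≤
      firstWin f (fun a => 1 - h a) (fun a => g a - f a) (fun a => h a - g a)
        (laterWin g fun a => 1 - h a) (fun l => 1 - listProd k l) l := by
  induction l with
  | nil => simp [firstWin]
  | cons a l ih =>
    have hl := fun b hb => hf b (List.mem_cons_of_mem a hb)
    have ih := ih hl
    have hgl : ∀ b ∈ l, 0 < g b := fun b hb => (hl b hb).trans_le (hfg b)
    have hU := laterWin_ge hgh (fun a => (hhk a).trans (hk1 a)) hgl
    have hfa := hf a (by simp)
    have hF := listProd_pos hl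
    have hFG := listProd_mono hl hfg
    have hG := hF.trans_le hFG
    have hGH := listProd_mono hgl hgh
    have hH := hG.trans_le hGH
    have hkl : ∀ b ∈ l, 0 < k b := fun b hb => (hgl b hb).trans_le ((hgh b).trans (hhk b))
    have hK := listProd_pos hkl
    have hK1 := listProd_le_one (fun b hb => (hkl b hb).le) hk1
    have hga := hfa.trans_le (hfg a)
    have hha := hga.trans_le (hgh a)
    have hfga := hfg a
    have hgha := hgh a
    have hhka := hhk a
    have hk1a := hk1 a
    simp only [firstWin, listProd_cons]
    generalize firstWin f _ _ _ _ _ l = W at *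
    generalize laterWin g _ l = U at *
    generalize listProd f l = F at *
    generalize listProd g l = G at *
    generalize listProd h l = H at *
    generalize listProd k l = K at *
    generalize f a = x at *
    generalize g a = y at *
    generalize h a = z at *
    generalize k a = w at *
    have e1 : y * G / (z * H) = y / z * (G / H) := by field_simp
    have e2 : x * F / (y * G) = x / y * (F / G) := by field_simp
    rw [e1, e2]
    have b1 : y / z ≤ 1 := (div_le_one hha).2 hgha
    have b2 : G / H ≤ 1 := (div_le_one hH).2 hGH
    have b3 : x / y ≤ 1 := (div_le_one hga).2 hfga
    have b4 : F / G ≤ 1 := (div_le_one hG).2 hFG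
    have p1 : 0 ≤ y / z := by positivity
    have p2 : 0 ≤ G / H := by positivity
    have p3 : 0 ≤ x / y := by positivity
    have p4 : 0 ≤ F / G := by positivity
    have m1 : x / y * y = x := by field_simp
    have m2 : y / z * z = y := by field_simp
    have q1 : y / z * (G / H) ≤ 1 := mul_le_one₀ b1 p2 b2
    have q2 : x / y * (F / G) ≤ 1 := mul_le_one₀ b3 p4 b4
    have q3 : 0 ≤ x / y * (F / G) := by positivity
    have r1 := mul_le_mul_of_nonneg_left ih hfa.le
    have r2 := mul_le_mul_of_nonneg_left hU (sub_nonneg.2 hfga)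
    set φ := x / y * (F / G) with hφ
    set ψ := y / z * (G / H) with hψ
    have m3 : x * (F / G) = y * φ := by rw [hφ, ← m1]; field_simp
    have m4 : y * (G / H) = z * ψ := by rw [hψ, ← m2]; field_simp
    -- With `1 - w K = (1 - K) + K (1 - w)`, the remaining difference of the two sides is the gap in
    -- `s1` plus the quantity in `s2`.
    have s1 : φ * (1 - ψ) * (K * (1 - w)) ≤ (1 - ψ) * (K * (1 - z)) := by
      have : 0 ≤ K * (1 - w) := mul_nonneg hK.le (by linarith)
      calc φ * (1 - ψ) * (K * (1 - w)) ≤ 1 * (1 - ψ) * (K * (1 - w)) := by gcongr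
        _ = (1 - ψ) * (K * (1 - w)) := by ring
        _ ≤ (1 - ψ) * (K * (1 - z)) := by gcongr
    have s2 : 0 ≤ (1 - K) * ((1 - φ) * ((1 - z) * (1 - ψ) + (z - y))) := by
      apply mul_nonneg (by linarith)
      apply mul_nonneg (by linarith)
      nlinarith
    have t1 : x * (F / G * (1 - G / H) * (1 - K)) = φ * (y - z * ψ) * (1 - K) := by
      rw [← m4]
      linear_combination ((1 - G / H) * (1 - K)) * m3
    have t2 : y * (G / H - G) = z * ψ - y * G := by rw [← m4]; ring
    nlinarith

/-- Probability that at most one item was accepted and no item exceeds the level, which lies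
above the third threshold. -/
def openProb (f g h k : α → ℝ) : List α → ℝ
  | [] => 1
  | a :: l => f a * openProb f g h k l + (g a - f a) * listProd g l + (h a - g a) * listProd k l

lemma laterWin_concat (d w : α → ℝ) (l : List α) (a : α) :
    laterWin d w (l ++ [a]) = laterWin d w l + listProd d l * w a := by
  induction l with
  | nil => simp [laterWin]
  | cons b l ih => rw [List.cons_append, laterWin, laterWin, ih, listProd_cons]; ring

/-- When the level is above all thresholds, a final item changes the outcome only by exceeding the
level while the algorithm is open. This allows induction from the end of the list. -/
lemma firstWin_concat (f g h k : α → ℝ) (l : List α) (a : α) :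
    firstWin f (fun a => 1 - h a) (fun a => g a - f a) (fun a => h a - g a)
        (laterWin g fun a => 1 - h a) (laterWin k fun a => 1 - h a) (l ++ [a]) =
      firstWin f (fun a => 1 - h a) (fun a => g a - f a) (fun a => h a - g a)
        (laterWin g fun a => 1 - h a) (laterWin k fun a => 1 - h a) l +
      openProb f g h k l * (1 - h a) := by
  induction l with
  | nil => simp [firstWin, openProb, laterWin]
  | cons b l ih =>
    simp only [List.cons_append, firstWin, ih, openProb, laterWin_concat]; ring

/-- Lower bound on the probability of being open, for products `p ≤ q ≤ r`. -/
noncomputable def openBound (p q r : ℝ) : ℝ := q - p - p * Real.log r + p * r / q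

lemma neg_mul_log_le {x : ℝ} (hx : 0 < x) : -(x * Real.log x) ≤ 1 - x := by
  have h := Real.log_le_sub_one_of_pos (inv_pos.2 hx)
  rw [Real.log_inv] at h
  have h' := mul_le_mul_of_nonneg_left h hx.le
  have : x * (x⁻¹ - 1) = 1 - x := by field_simp
  linarith

/-- Further items only lower the bound, so its value at the full products is valid for every prefix.
-/
lemma openBound_mul_le {p q r x y z : ℝ} (hp : 0 < p) (hpq : p ≤ q) (hqr : q ≤ r) (hr : r ≤ 1)
    (hx : 0 < x) (hxy : x ≤ y) (hyz : y ≤ z) (hz : z ≤ 1) :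
    openBound (p * x) (q * y) (r * z) ≤ openBound p q r := by
  have hq := hp.trans_le hpq
  have hr0 := hq.trans_le hqr
  have hy := hx.trans_le hxy
  have hz0 := hy.trans_le hyz
  -- In the coordinates `x = s t z`, `y = t z`, the constraints become `s, t, z ≤ 1`, and each
  -- coordinate can be raised to `1` separately: `step1` for `s`, `step2` for `t`, `step3` and
  -- `step4` for `z`.
  obtain ⟨s, rfl⟩ : ∃ s, x = s * y := ⟨x / y, by field_simp⟩
  obtain ⟨t, rfl⟩ : ∃ t, y = t * z := ⟨y / z, by field_simp⟩
  have hs1 : s ≤ 1 := by nlinarith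
  have ht1 : t ≤ 1 := by nlinarith
  have ht : 0 < t := by by_contra! h; nlinarith
  have hs : 0 < s := by by_contra! h; nlinarith
  have hL := Real.log_nonpos hr0.le hr
  have hl := Real.log_nonpos hz0.le hz
  have hzl := neg_mul_log_le hz0
  have key : p * (s * (t * z)) * (r * z) / (q * (t * z)) = p * r / q * (s * z) := by field_simp
  have hB : p ≤ p * r / q := by
    rw [le_div_iff₀ hq]; exact mul_le_mul_of_nonneg_left hqr hp.le
  simp only [openBound]
  rw [key, Real.log_mul hr0.ne' hz0.ne']
  generalize p * r / q = B at *
  generalize Real.log r = L at *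
  generalize Real.log z = ℓ at *
  have step1 : 0 ≤ (1 - s) * z * (B - p * t * (1 + L + ℓ)) := by
    refine mul_nonneg (mul_nonneg (by linarith) hz0.le) ?_
    have h1 : p * t ≤ p := by nlinarith
    have h2 : 0 ≤ p * t * (-L - ℓ) := mul_nonneg (by positivity) (by linarith)
    nlinarith
  have step2 : 0 ≤ (1 - t) * z * (q - p * (1 + L + ℓ)) := by
    refine mul_nonneg (mul_nonneg (by linarith) hz0.le) ?_
    have h2 : 0 ≤ p * (-L - ℓ) := mul_nonneg hp.le (by linarith)
    nlinarith
  have step3 : 0 ≤ (1 - z) * (q - p * L + B - 2 * p) := by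
    refine mul_nonneg (by linarith) ?_
    have h2 : 0 ≤ p * (-L) := mul_nonneg hp.le (by linarith)
    nlinarith
  have step4 := mul_le_mul_of_nonneg_left hzl hp.le
  nlinarith

/-- The extremal order is mass in `[τ₁, τ₂)`, then in `[τ₂, τ₃)`, then in `[τ₃, t]` spread over ever
smaller items. The last stage is a limit, whence the logarithm; item by item it enters through `-x
log x ≤ 1 - x` at `x = k a / h a`. -/
lemma openProb_ge {f g h k : α → ℝ} (hfg : ∀ a, f a ≤ g a) (hgk : ∀ a, g a ≤ k a)
    (hkh : ∀ a, k a ≤ h a) {l : List α} (hf : ∀ a ∈ l, 0 < f a) :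
    listProd g l - listProd f l - listProd f l * Real.log (listProd k l / listProd h l) +
        listProd f l * listProd k l / listProd g l ≤ openProb f g h k l := by
  induction l with
  | nil => simp [openProb]
  | cons a l ih =>
    have hl := fun b hb => hf b (List.mem_cons_of_mem a hb)
    have ih := ih hl
    have hgl : ∀ b ∈ l, 0 < g b := fun b hb => (hl b hb).trans_le (hfg b)
    have hkl : ∀ b ∈ l, 0 < k b := fun b hb => (hgl b hb).trans_le (hgk b)
    have hfa := hf a (by simp)
    have hF := listProd_pos hl
    have hFG := listProd_mono hl hfg
    have hG := hF.trans_le hFG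
    have hGK := listProd_mono hgl hgk
    have hK := hG.trans_le hGK
    have hKH := listProd_mono hkl hkh
    have hH := hK.trans_le hKH
    have hga := hfa.trans_le (hfg a)
    have hka := hga.trans_le (hgk a)
    have hha := hka.trans_le (hkh a)
    have hfga := hfg a
    have hgka := hgk a
    have hkha := hkh a
    have hlog : Real.log (k a * listProd k l / (h a * listProd h l)) =
        Real.log (k a / h a) + Real.log (listProd k l / listProd h l) := by
      rw [← Real.log_mul (by positivity) (by positivity)]; congr 1; field_simp
    simp only [openProb, listProd_cons]
    rw [hlog]
    have hln := neg_mul_log_le (show 0 < k a / h a by positivity)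
    have hln0 : Real.log (k a / h a) ≤ 0 :=
      Real.log_nonpos (by positivity) ((div_le_one hha).2 hkha)
    generalize openProb f g h k l = W at *
    generalize Real.log (listProd k l / listProd h l) = L at *
    generalize Real.log (k a / h a) = ℓ at *
    generalize listProd f l = F at *
    generalize listProd g l = G at *
    generalize listProd k l = K at *
    generalize f a = x at *
    generalize g a = y at *
    generalize h a = z at *
    generalize k a = w at *
    have hln' : -(w * ℓ) ≤ z - w := by
      have := mul_le_mul_of_nonneg_left hln hha.le
      have e1 : z * -(w / z * ℓ) = -(w * ℓ) := by field_simp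
      have e2 : z * (1 - w / z) = z - w := by field_simp
      linarith
    have e1 : x * F * (w * K) / (y * G) = x / y * (F / G) * (w * K) := by field_simp
    have e2 : F * K / G = F / G * K := by ring
    rw [e2] at ih
    rw [e1]
    have b3 : x / y ≤ 1 := (div_le_one hga).2 hfga
    have b4 : F / G ≤ 1 := (div_le_one hG).2 hFG
    have p4 : 0 ≤ F / G := by positivity
    have q2 : x / y * (F / G) ≤ 1 := mul_le_one₀ b3 p4 b4
    have q3 : 0 ≤ x / y * (F / G) := by positivity
    have m1 : x * F = x / y * (F / G) * (y * G) := by field_simp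
    have m2 : x * (F / G) = x / y * (F / G) * y := by field_simp
    set φ := x / y * (F / G)
    have r1 := mul_le_mul_of_nonneg_left ih hfa.le
    -- The excess over the bound is the quantity in `s1` plus `φ` times the gap in `s2`.
    have s1 : 0 ≤ (1 - φ) * ((z - y) * K) :=
      mul_nonneg (by linarith) (mul_nonneg (by linarith) hK.le)
    have s2 : y * G * -ℓ ≤ (z - w) * K :=
      calc y * G * -ℓ ≤ w * K * -ℓ := by
            have : 0 ≤ -ℓ := by linarith
            gcongr
        _ = -(w * ℓ) * K := by ring
        _ ≤ (z - w) * K := by gcongr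
    have s3 := mul_le_mul_of_nonneg_left s2 q3
    have e3 : x * (G - F - F * L + F / G * K) = x * G - x * F - x * F * L + φ * y * K := by
      rw [← m2]; ring
    have e4 : x * F * (ℓ + L) = x * F * L + φ * (y * G) * ℓ := by rw [← m1]; ring
    rw [e3] at r1
    rw [e4]
    nlinarith

/-- The level lies above the third threshold. -/
lemma firstWin_ge_of_high {f g h k : α → ℝ} (hfg : ∀ a, f a ≤ g a) (hgk : ∀ a, g a ≤ k a)
    (hkh : ∀ a, k a ≤ h a) (hh1 : ∀ a, h a ≤ 1) {l : List α} (hf : ∀ a ∈ l, 0 < f a) :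
    openBound (listProd f l) (listProd g l) (listProd k l) * (1 - listProd h l) ≤
      firstWin f (fun a => 1 - h a) (fun a => g a - f a) (fun a => h a - g a)
        (laterWin g fun a => 1 - h a) (laterWin k fun a => 1 - h a) l := by
  set C := openBound (listProd f l) (listProd g l) (listProd k l) with hC
  -- On every prefix, given that no value exceeds the level, the algorithm is open with probability
  -- at least `C`, the constant of the full list.
  have hopen : ∀ l₁ l₂, l₁ ++ l₂ = l → C * listProd h l₁ ≤ openProb f g h k l₁ := by
    rintro l₁ l₂ rfl
    have hl₁ : ∀ a ∈ l₁, 0 < f a := fun a ha => hf a (by simp [ha])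
    have hl₂ : ∀ a ∈ l₂, 0 < f a := fun a ha => hf a (by simp [ha])
    have pos : ∀ l' : List α, (∀ a ∈ l', 0 < f a) → 0 < listProd f l' ∧
        listProd f l' ≤ listProd g l' ∧ listProd g l' ≤ listProd k l' ∧
        listProd k l' ≤ listProd h l' ∧ listProd h l' ≤ 1 := by
      intro l' h'
      have hg' : ∀ a ∈ l', 0 < g a := fun a ha => (h' a ha).trans_le (hfg a)
      have hk' : ∀ a ∈ l', 0 < k a := fun a ha => (hg' a ha).trans_le (hgk a)
      have hh' : ∀ a ∈ l', 0 < h a := fun a ha => (hk' a ha).trans_le (hkh a)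
      exact ⟨listProd_pos h', listProd_mono h' hfg, listProd_mono hg' hgk,
        listProd_mono hk' hkh, listProd_le_one (fun b hb => (hh' b hb).le) hh1⟩
    obtain ⟨a1, a2, a3, a4, a5⟩ := pos l₁ hl₁
    obtain ⟨b1, b2, b3, b4, b5⟩ := pos l₂ hl₂
    refine le_trans ?_ (openProb_ge hfg hgk hkh hl₁)
    simp only [listProd_append] at hC
    generalize listProd f l₁ = F at *
    generalize listProd g l₁ = G at *
    generalize listProd h l₁ = H at *
    generalize listProd k l₁ = K at *
    have hG : 0 < G := by linarith
    have hK : 0 < K := by linarith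
    have hH : 0 < H := by linarith
    -- Dividing by `H` conditions the prefix on staying below the level. The extra factor `H` on the
    -- suffix restores the full products; the factors stay ordered and at most `1`.
    have hmono : openBound (F / H * (H * listProd f l₂)) (G / H * (H * listProd g l₂))
        (K / H * (H * listProd k l₂)) ≤ openBound (F / H) (G / H) (K / H) := by
      apply openBound_mul_le
      · positivity
      · gcongr
      · gcongr
      · exact (div_le_one hH).2 a4
      · positivity
      · gcongr
      · gcongr
      · exact mul_le_one₀ a5 (by linarith) (by linarith)
    have e : ∀ A B : ℝ, A / H * (H * B) = A * B := fun A B => by field_simp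
    rw [e, e, e, ← hC] at hmono
    have hfin : openBound (F / H) (G / H) (K / H) * H =
        G - F - F * Real.log (K / H) + F * K / G := by
      unfold openBound; field_simp
    rw [← hfin]
    exact mul_le_mul_of_nonneg_right hmono hH.le
  -- `C` belongs to the full list and must stay fixed while the induction shortens the list.
  clear_value C
  clear hC hf
  induction l using List.reverseRecOn with
  | nil => simp [firstWin]
  | append_singleton l a ih =>
    have h1 := ih fun l₁ l₂ h => hopen l₁ (l₂ ++ [a]) (by rw [← h]; simp)
    have h2 := mul_le_mul_of_nonneg_right (hopen l [a] rfl) (sub_nonneg.2 (hh1 a))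
    rw [firstWin_concat, listProd_append, listProd_cons, listProd_nil]
    linarith

end Recursion

/-- Minimising `A + x² / h` over the level. -/
lemma sq_mul_one_sub_le (x y : ℝ) {h : ℝ} (hh : 0 < h) :
    (x + y) ^ 2 * (1 - h) ≤ y ^ 2 - x ^ 2 + x ^ 2 / h := by
  -- Equality holds at the minimiser `h = x / (x + y)`.
  have : y ^ 2 - x ^ 2 + x ^ 2 / h - (x + y) ^ 2 * (1 - h) = ((x + y) * h - x) ^ 2 / h := by
    field_simp; ring
  have h2 : 0 ≤ ((x + y) * h - x) ^ 2 / h := by positivity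
  linarith

/-! ### Level sets of the reward as recursive events -/

section Events

/-- The first value reaching `θ` exceeds `t`. -/
def LaterHit (θ t : ℝ) : List ℝ → Prop
  | [] => False
  | x :: l => (x < θ ∧ LaterHit θ t l) ∨ (θ ≤ x ∧ t < x)

/-- One of the two accepted values exceeds `t`: the first threshold is `τ₁`, the second one is
`τ₂` after a first acceptance below `τ₂`, and `τ₃` otherwise. -/
def Hit (τ₁ τ₂ τ₃ t : ℝ) : List ℝ → Prop
  | [] => False
  | x :: l => (x < τ₁ ∧ Hit τ₁ τ₂ τ₃ t l) ∨ (τ₁ ≤ x ∧ t < x) ∨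
      ((τ₁ ≤ x ∧ x ≤ t ∧ x < τ₂) ∧ LaterHit τ₂ t l) ∨
      ((τ₁ ≤ x ∧ x ≤ t ∧ τ₂ ≤ x) ∧ LaterHit τ₃ t l)

variable {m : ℕ} {τ : Fin m → ℝ} {next : Fin m → ℝ → Fin m}

lemma foldl_step_of_length {s : State m} (hs : s.accepted.length = 2) (l : List ℝ) :
    l.foldl (step τ next) s = s := by
  induction l with
  | nil => rfl
  | cons x l ih => rw [List.foldl_cons, step, if_neg (by simp [hs]), ih]

/-- `0 ≤ t` keeps the default reward `0` from exceeding the level. -/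
lemma lt_reward_foldl_singleton {t : ℝ} (ht : 0 ≤ t) (r : Fin m) (v : ℝ) (l : List ℝ) :
    t < reward (l.foldl (step τ next) ⟨r, [v]⟩) ↔ t < v ∨ LaterHit (τ r) t l := by
  induction l with
  | nil => simp [reward, LaterHit, ht.not_gt]
  | cons x l ih =>
    rw [List.foldl_cons, LaterHit]
    rcases lt_or_ge x (τ r) with hx | hx
    · rw [step, if_neg (by simp [hx]), ih]
      simp [hx, hx.not_ge]
    · rw [step, if_pos ⟨by simp, hx⟩, foldl_step_of_length rfl]
      simp [reward, hx, hx.not_gt, ht.not_gt, or_comm]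

/-- Covers both algorithms: only the threshold chosen at the first acceptance matters, so `next` is
constrained only at index `0` and at values reaching `τ 0`. -/
lemma lt_reward_run {n : ℕ} [NeZero m] {τ₂ τ₃ t : ℝ} (ht : 0 ≤ t)
    (hnext : ∀ v, τ 0 ≤ v → τ (next 0 v) = if v < τ₂ then τ₂ else τ₃) (x : Fin n → ℝ) :
    t < reward (run τ next x) ↔ Hit (τ 0) τ₂ τ₃ t (List.ofFn x) := by
  rw [run]
  induction List.ofFn x with
  | nil => simp [reward, Hit, ht.not_gt]
  | cons x l ih =>
    rw [List.foldl_cons, Hit]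
    rcases lt_or_ge x (τ 0) with hx | hx
    · rw [step, if_neg (by simp [hx]), ih]
      simp [hx, hx.not_ge]
    · rw [step, if_pos ⟨by simp, hx⟩, lt_reward_foldl_singleton ht, hnext x hx]
      rcases lt_or_ge t x with htx | htx <;> rcases lt_or_ge x τ₂ with h2 | h2 <;>
        simp [hx, htx, h2, hx.not_gt, not_lt_of_ge, not_le_of_gt]

lemma lt_alg₂ {n : ℕ} {τ : Fin 2 → ℝ} {t : ℝ} (ht : 0 ≤ t) (x : Fin n → ℝ) :
    t < alg₂ τ x ↔ Hit (τ 0) (τ 1) (τ 1) t (List.ofFn x) :=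
  lt_reward_run ht (fun v _ => by simp) x

lemma nextIndex_of_le {τ : Fin 3 → ℝ} {v : ℝ} (hv : τ 0 ≤ v) :
    nextIndex τ v = if v < τ 1 then 1 else 2 := by
  have h : (insert (2 : Fin 3) (Finset.univ.filter fun k => v < τ k)) =
      if v < τ 1 then {1, 2} else {2} := by
    ext k
    fin_cases k <;> by_cases h1 : v < τ 1 <;> simp [hv, h1]
  unfold nextIndex
  by_cases h1 : v < τ 1
  · simp only [h, h1, if_true]; rfl
  · simp only [h, h1, if_false]; rfl

lemma lt_alg₃ {n : ℕ} {τ : Fin 3 → ℝ} {t : ℝ} (ht : 0 ≤ t) (x : Fin n → ℝ) :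
    t < alg₃ τ x ↔ Hit (τ 0) (τ 1) (τ 2) t (List.ofFn x) :=
  lt_reward_run ht (fun v hv => by rw [nextIndex_of_le hv]; split_ifs <;> rfl) x

lemma reward_nonneg (s : State m) : 0 ≤ reward s := by
  unfold reward
  induction s.accepted with
  | nil => simp
  | cons x l ih => simp [ih]

end Events

/-! ### Probabilities of these events under a product law -/

section Product

lemma setOf_laterHit_succ {n : ℕ} (θ t : ℝ) :
    {x : Fin (n + 1) → ℝ | LaterHit θ t (List.ofFn x)} =
      {x | x 0 ∈ Set.Iio θ ∧ (fun i : Fin n => x i.succ) ∈ {y | LaterHit θ t (List.ofFn y)}} ∪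
      {x | x 0 ∈ Set.Ici θ ∩ Set.Ioi t ∧ (fun i : Fin n => x i.succ) ∈ Set.univ} := by
  ext x
  simp [List.ofFn_succ, LaterHit]

/-- The pieces are disjoint rectangles in (head, tail), so measurability and the recursion for the
probability both follow by induction on `n`. -/
lemma setOf_hit_succ {n : ℕ} (τ₁ τ₂ τ₃ t : ℝ) :
    {x : Fin (n + 1) → ℝ | Hit τ₁ τ₂ τ₃ t (List.ofFn x)} =
      {x | x 0 ∈ Set.Iio τ₁ ∧
        (fun i : Fin n => x i.succ) ∈ {y | Hit τ₁ τ₂ τ₃ t (List.ofFn y)}} ∪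
      ({x | x 0 ∈ Set.Ici τ₁ ∩ Set.Ioi t ∧ (fun i : Fin n => x i.succ) ∈ Set.univ} ∪
      ({x | x 0 ∈ Set.Icc τ₁ t ∩ Set.Iio τ₂ ∧
        (fun i : Fin n => x i.succ) ∈ {y | LaterHit τ₂ t (List.ofFn y)}} ∪
      {x | x 0 ∈ Set.Icc τ₁ t ∩ Set.Ici τ₂ ∧
        (fun i : Fin n => x i.succ) ∈ {y | LaterHit τ₃ t (List.ofFn y)}})) := by
  ext x
  simp [List.ofFn_succ, Hit, and_assoc]

lemma measurableSet_head_tail {n : ℕ} {A : Set ℝ} {T : Set (Fin n → ℝ)} (hA : MeasurableSet A)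
    (hT : MeasurableSet T) :
    MeasurableSet {x : Fin (n + 1) → ℝ | x 0 ∈ A ∧ (fun i : Fin n => x i.succ) ∈ T} :=
  ((measurable_pi_apply 0) hA).inter
    ((measurable_pi_lambda (fun (x : Fin (n + 1) → ℝ) (i : Fin n) => x i.succ)
      fun i => measurable_pi_apply i.succ) hT)

lemma measurableSet_laterHit (n : ℕ) (θ t : ℝ) :
    MeasurableSet {x : Fin n → ℝ | LaterHit θ t (List.ofFn x)} := by
  induction n with
  | zero => simp [LaterHit]
  | succ n ih =>
    rw [setOf_laterHit_succ]
    exact (measurableSet_head_tail measurableSet_Iio ih).union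
      (measurableSet_head_tail (measurableSet_Ici.inter measurableSet_Ioi) .univ)

lemma measurableSet_hit (n : ℕ) (τ₁ τ₂ τ₃ t : ℝ) :
    MeasurableSet {x : Fin n → ℝ | Hit τ₁ τ₂ τ₃ t (List.ofFn x)} := by
  induction n with
  | zero => simp [Hit]
  | succ n ih =>
    rw [setOf_hit_succ]
    exact (measurableSet_head_tail measurableSet_Iio ih).union
      ((measurableSet_head_tail (measurableSet_Ici.inter measurableSet_Ioi) .univ).union
      ((measurableSet_head_tail (measurableSet_Icc.inter measurableSet_Iio)
        (measurableSet_laterHit n _ _)).union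
      (measurableSet_head_tail (measurableSet_Icc.inter measurableSet_Ici)
        (measurableSet_laterHit n _ _))))

/-- The product of probability measures on the line. -/
noncomputable abbrev law {n : ℕ} (ν : Fin n → ProbabilityMeasure ℝ) : Measure (Fin n → ℝ) :=
  Measure.pi fun i => (ν i : Measure ℝ)

lemma law_real_head_tail {n : ℕ} (ν : Fin (n + 1) → ProbabilityMeasure ℝ) (A : Set ℝ)
    (T : Set (Fin n → ℝ)) :
    (law ν).real {x | x 0 ∈ A ∧ (fun i : Fin n => x i.succ) ∈ T} =
      (ν 0 : Measure ℝ).real A * (law fun i => ν i.succ).real T := by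
  have h := (measurePreserving_piFinSuccAbove (fun i => (ν i : Measure ℝ)) 0).measure_preimage_equiv
    (A ×ˢ T)
  rw [Measure.prod_prod] at h
  simp only [measureReal_def, ← ENNReal.toReal_mul]
  congr 1

lemma law_real_laterHit {n : ℕ} (ν : Fin n → ProbabilityMeasure ℝ) (θ t : ℝ) :
    (law ν).real {x | LaterHit θ t (List.ofFn x)} =
      laterWin (fun μ : ProbabilityMeasure ℝ => (μ : Measure ℝ).real (Set.Iio θ))
        (fun μ => (μ : Measure ℝ).real (Set.Ici θ ∩ Set.Ioi t)) (List.ofFn ν) := by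
  induction n with
  | zero => simp [LaterHit, laterWin]
  | succ n ih =>
    rw [setOf_laterHit_succ, measureReal_union, law_real_head_tail, law_real_head_tail, ih,
      List.ofFn_succ, laterWin]
    · simp [add_comm]
    · rw [Set.disjoint_left]
      rintro x ⟨h, -⟩ ⟨⟨h', -⟩, -⟩
      exact (Set.mem_Iio.1 h).not_ge h'
    · exact measurableSet_head_tail (measurableSet_Ici.inter measurableSet_Ioi) .univ

lemma law_real_hit {n : ℕ} (ν : Fin n → ProbabilityMeasure ℝ) (τ₁ τ₂ τ₃ t : ℝ) :
    (law ν).real {x | Hit τ₁ τ₂ τ₃ t (List.ofFn x)} =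
      firstWin (fun μ : ProbabilityMeasure ℝ => (μ : Measure ℝ).real (Set.Iio τ₁))
        (fun μ => (μ : Measure ℝ).real (Set.Ici τ₁ ∩ Set.Ioi t))
        (fun μ => (μ : Measure ℝ).real (Set.Icc τ₁ t ∩ Set.Iio τ₂))
        (fun μ => (μ : Measure ℝ).real (Set.Icc τ₁ t ∩ Set.Ici τ₂))
        (laterWin (fun μ : ProbabilityMeasure ℝ => (μ : Measure ℝ).real (Set.Iio τ₂))
          (fun μ => (μ : Measure ℝ).real (Set.Ici τ₂ ∩ Set.Ioi t)))
        (laterWin (fun μ : ProbabilityMeasure ℝ => (μ : Measure ℝ).real (Set.Iio τ₃))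
          (fun μ => (μ : Measure ℝ).real (Set.Ici τ₃ ∩ Set.Ioi t))) (List.ofFn ν) := by
  induction n with
  | zero => simp [Hit, firstWin]
  | succ n ih =>
    have mW : MeasurableSet {x : Fin (n + 1) → ℝ | x 0 ∈ Set.Ici τ₁ ∩ Set.Ioi t ∧
        (fun i : Fin n => x i.succ) ∈ Set.univ} :=
      measurableSet_head_tail (measurableSet_Ici.inter measurableSet_Ioi) .univ
    have mB : MeasurableSet {x : Fin (n + 1) → ℝ | x 0 ∈ Set.Icc τ₁ t ∩ Set.Iio τ₂ ∧
        (fun i : Fin n => x i.succ) ∈ {y | LaterHit τ₂ t (List.ofFn y)}} :=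
      measurableSet_head_tail (measurableSet_Icc.inter measurableSet_Iio)
        (measurableSet_laterHit n _ _)
    have mC : MeasurableSet {x : Fin (n + 1) → ℝ | x 0 ∈ Set.Icc τ₁ t ∩ Set.Ici τ₂ ∧
        (fun i : Fin n => x i.succ) ∈ {y | LaterHit τ₃ t (List.ofFn y)}} :=
      measurableSet_head_tail (measurableSet_Icc.inter measurableSet_Ici)
        (measurableSet_laterHit n _ _)
    rw [setOf_hit_succ, measureReal_union _ (mW.union (mB.union mC)),
      measureReal_union _ (mB.union mC), measureReal_union _ mC,
      law_real_head_tail, law_real_head_tail, law_real_head_tail, law_real_head_tail, ih,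
      law_real_laterHit, law_real_laterHit, List.ofFn_succ, firstWin]
    · simp [add_assoc]
    · rw [Set.disjoint_left]
      rintro x ⟨⟨-, h⟩, -⟩ ⟨⟨-, h'⟩, -⟩
      exact (Set.mem_Iio.1 h).not_ge h'
    · rw [Set.disjoint_left]
      rintro x ⟨⟨-, h⟩, -⟩ (⟨⟨⟨-, h'⟩, -⟩, -⟩ | ⟨⟨⟨-, h'⟩, -⟩, -⟩) <;> exact absurd h (not_lt.2 h')
    · rw [Set.disjoint_left]
      rintro x ⟨h, -⟩ (⟨⟨h', -⟩, -⟩ | ⟨⟨⟨h', -⟩, -⟩, -⟩ | ⟨⟨⟨h', -⟩, -⟩, -⟩) <;>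
        exact (Set.mem_Iio.1 h).not_ge h'

end Product

/-! ### The constants as minima over the level -/

section Constants

/-- This is the form `(x + y)²` of `sq_mul_one_sub_le`, with `x² = F G` and `y² = (1 - F)(1 - G)`,
so that `y² - x² = 1 - F - G`. -/
lemma C₂_eq_sq {c₁ c₂ : ℝ} (h₁ : 0 < c₁) (h₂ : 0 < c₂) :
    C₂ c₁ c₂ = (√(Real.exp (-c₁) * Real.exp (-c₂)) +
      √((1 - Real.exp (-c₁)) * (1 - Real.exp (-c₂)))) ^ 2 := by
  have hp1 : Real.exp (-c₁) < 1 := Real.exp_lt_one_iff.2 (by linarith)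
  have hq1 : Real.exp (-c₂) < 1 := Real.exp_lt_one_iff.2 (by linarith)
  have hp := Real.exp_pos (-c₁)
  have hq := Real.exp_pos (-c₂)
  have e1 : Real.exp c₁ = (Real.exp (-c₁))⁻¹ := by rw [Real.exp_neg, inv_inv]
  have e2 : Real.exp c₂ = (Real.exp (-c₂))⁻¹ := by rw [Real.exp_neg, inv_inv]
  rw [C₂, sub_eq_add_neg (-c₁), Real.exp_add, e1, e2]
  generalize Real.exp (-c₁) = p at *
  generalize Real.exp (-c₂) = q at *
  have hs : √((p⁻¹ - 1) * (q⁻¹ - 1)) = √(p * q) * √((1 - p) * (1 - q)) / (p * q) := by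
    have h1p := sub_pos.2 hp1
    have h1q := sub_pos.2 hq1
    have e : (p⁻¹ - 1) * (q⁻¹ - 1) = p * q * ((1 - p) * (1 - q)) / (p * q) ^ 2 := by
      field_simp
    rw [e, Real.sqrt_div (by positivity), Real.sqrt_sq (by positivity),
      Real.sqrt_mul (by positivity)]
  have hx := Real.sq_sqrt (show 0 ≤ p * q by positivity)
  have hy := Real.sq_sqrt (mul_nonneg (sub_nonneg.2 hp1.le) (sub_nonneg.2 hq1.le))
  rw [hs, add_sq, hx, hy]
  field_simp
  ring

/-- With `m = F (1 - K) / G` the bound for the middle range is `m - G + G (1 - m) / H`, which is `y²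
- x² + x² / H` for `x² = G (1 - m)` and `y² = m (1 - G)`. -/
lemma C₃_eq_sq {c₁ c₂ c₃ m : ℝ} (h₁₂ : c₂ ≤ c₁) (h₂ : 0 < c₂) (h₃ : 0 < c₃)
    (hm : m = Real.exp (-c₁) * (1 - Real.exp (-c₃)) / Real.exp (-c₂)) :
    C₃ c₁ c₂ c₃ = (√(Real.exp (-c₂) * (1 - m)) + √(m * (1 - Real.exp (-c₂)))) ^ 2 := by
  have hpq : Real.exp (-c₁) ≤ Real.exp (-c₂) := Real.exp_le_exp.2 (by linarith)
  have hq1 : Real.exp (-c₂) < 1 := Real.exp_lt_one_iff.2 (by linarith)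
  have hk1 : Real.exp (-c₃) < 1 := Real.exp_lt_one_iff.2 (by linarith)
  have hp := Real.exp_pos (-c₁)
  have hq := Real.exp_pos (-c₂)
  have hk := Real.exp_pos (-c₃)
  have e1 : Real.exp c₁ = (Real.exp (-c₁))⁻¹ := by rw [Real.exp_neg, inv_inv]
  have e2 : Real.exp c₂ = (Real.exp (-c₂))⁻¹ := by rw [Real.exp_neg, inv_inv]
  have e3 : Real.exp c₃ = (Real.exp (-c₃))⁻¹ := by rw [Real.exp_neg, inv_inv]
  rw [C₃, Real.cosh_sub_sinh, neg_add, neg_add, Real.exp_add, Real.exp_add, Real.exp_add,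
    Real.exp_add, e1, e2, e3]
  generalize Real.exp (-c₁) = p at *
  generalize Real.exp (-c₂) = q at *
  generalize Real.exp (-c₃) = k at *
  have hm0 : 0 < m := by
    rw [hm]; exact div_pos (mul_pos hp (sub_pos.2 hk1)) hq
  have hm1 : m < 1 := by
    rw [hm, div_lt_one hq]; nlinarith
  have hpe : p * (1 - k) = m * q := by rw [hm]; field_simp
  have h1m := sub_pos.2 hm1
  have h1q := sub_pos.2 hq1
  have hs : √(q⁻¹ * (q⁻¹ - 1) * (k⁻¹ - 1) * (q⁻¹ + p⁻¹ * k⁻¹ - q⁻¹ * k⁻¹)) =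
      √(q * (1 - m)) * √(m * (1 - q)) / (p * q * k) := by
    have e : q⁻¹ * (q⁻¹ - 1) * (k⁻¹ - 1) * (q⁻¹ + p⁻¹ * k⁻¹ - q⁻¹ * k⁻¹) =
        q * (1 - m) * (m * (1 - q)) / (p * q * k) ^ 2 := by
      rw [hm]; field_simp; ring
    rw [e, Real.sqrt_div (by positivity), Real.sqrt_sq (by positivity),
      Real.sqrt_mul (by positivity)]
  have hx := Real.sq_sqrt (show 0 ≤ q * (1 - m) by positivity)
  have hy := Real.sq_sqrt (show 0 ≤ m * (1 - q) by positivity)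
  rw [hs, add_sq, hx, hy]
  generalize √(q * (1 - m)) = x at *
  generalize √(m * (1 - q)) = y at *
  rw [hm]
  field_simp
  ring

lemma C₄_eq_openBound (c₁ c₂ c₃ : ℝ) :
    C₄ c₁ c₂ c₃ = openBound (Real.exp (-c₁)) (Real.exp (-c₂)) (Real.exp (-c₃)) := by
  have e : Real.exp (-c₁ + c₂ - c₃) =
      Real.exp (-c₁) * Real.exp (-c₃) / Real.exp (-c₂) := by
    rw [← Real.exp_add, ← Real.exp_sub]; congr 1; ring
  rw [C₄, openBound, Real.log_exp, e]
  ring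

lemma ratio₂_eq (c₁ c₂ : ℝ) :
    ratio₂ c₁ c₂ = min (C₁ c₁) (min (C₂ c₁ c₂) (C₄ c₁ c₂ c₂)) := by
  have e : -c₁ + c₂ - c₂ = -c₁ := by ring
  rw [ratio₂, C₁, C₂, C₄, e]
  ring_nf

end Constants

/-! ### The comparison at a fixed level, by the position of the level among the thresholds -/

section Bounds

lemma real_Ioi_eq (μ : ProbabilityMeasure ℝ) (t : ℝ) :
    (μ : Measure ℝ).real (Set.Ioi t) = 1 - (μ : Measure ℝ).real (Set.Iic t) := by
  rw [← Set.compl_Iic, probReal_compl_eq_one_sub measurableSet_Iic]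

lemma real_Ici_eq (μ : ProbabilityMeasure ℝ) (t : ℝ) :
    (μ : Measure ℝ).real (Set.Ici t) = 1 - (μ : Measure ℝ).real (Set.Iio t) := by
  rw [← Set.compl_Iio, probReal_compl_eq_one_sub measurableSet_Iio]

lemma real_Icc_eq (μ : ProbabilityMeasure ℝ) {s t : ℝ} (h : s ≤ t) :
    (μ : Measure ℝ).real (Set.Icc s t) =
      (μ : Measure ℝ).real (Set.Iic t) - (μ : Measure ℝ).real (Set.Iio s) := by
  have hsub : Set.Iio s ⊆ Set.Iic t := fun x hx => (Set.mem_Iio.1 hx).le.trans h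
  rw [← measureReal_sdiff hsub measurableSet_Iio]
  congr 1; ext x; simp

lemma real_Ico_eq (μ : ProbabilityMeasure ℝ) {s t : ℝ} (h : s ≤ t) :
    (μ : Measure ℝ).real (Set.Ico s t) =
      (μ : Measure ℝ).real (Set.Iio t) - (μ : Measure ℝ).real (Set.Iio s) := by
  rw [← measureReal_sdiff (Set.Iio_subset_Iio h) measurableSet_Iio]
  congr 1; ext x; simp

/-- The algorithm exceeds every level with at least `ρ` times the probability of the maximum. -/
lemma mul_one_sub_le_law_hit {n : ℕ} (ν : Fin n → ProbabilityMeasure ℝ) {c₁ c₂ c₃ : ℝ}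
    (hc₃ : 0 < c₃) (hc₃₂ : c₃ ≤ c₂) (hc₂₁ : c₂ < c₁) {τ₁ τ₂ τ₃ : ℝ} (hτ₁₂ : τ₁ < τ₂) (hτ₂₃ : τ₂ ≤ τ₃)
    (h₁ : listProd (fun μ : ProbabilityMeasure ℝ => (μ : Measure ℝ).real (Set.Iio τ₁))
      (List.ofFn ν) = Real.exp (-c₁))
    (h₂ : listProd (fun μ : ProbabilityMeasure ℝ => (μ : Measure ℝ).real (Set.Iio τ₂))
      (List.ofFn ν) = Real.exp (-c₂))
    (h₃ : listProd (fun μ : ProbabilityMeasure ℝ => (μ : Measure ℝ).real (Set.Iio τ₃))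
      (List.ofFn ν) = Real.exp (-c₃))
    {ρ : ℝ} (hρ₁ : ρ ≤ C₁ c₁) (hρ₂ : ρ ≤ C₂ c₁ c₂) (hρ₃ : τ₂ < τ₃ → ρ ≤ C₃ c₁ c₂ c₃)
    (hρ₄ : ρ ≤ C₄ c₁ c₂ c₃) (t : ℝ) :
    ρ * (1 - listProd (fun μ : ProbabilityMeasure ℝ => (μ : Measure ℝ).real (Set.Iic t))
        (List.ofFn ν)) ≤
      (law ν).real {x | Hit τ₁ τ₂ τ₃ t (List.ofFn x)} := by
  rw [law_real_hit]
  -- A vanishing factor would make the product `e^{-c₁}` vanish.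
  have hpos : ∀ μ ∈ List.ofFn ν, 0 < (μ : Measure ℝ).real (Set.Iio τ₁) := by
    intro μ hμ
    refine lt_of_le_of_ne measureReal_nonneg fun h0 => (Real.exp_pos (-c₁)).ne' ?_
    rw [← h₁]
    exact List.prod_eq_zero (List.mem_map.2 ⟨μ, hμ, h0.symm⟩)
  have hle1 : ∀ (s : Set ℝ) (μ : ProbabilityMeasure ℝ), (μ : Measure ℝ).real s ≤ 1 :=
    fun s μ => measureReal_le_one
  have hmono : ∀ {s s' : Set ℝ}, s ⊆ s' → ∀ μ : ProbabilityMeasure ℝ,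
      (μ : Measure ℝ).real s ≤ (μ : Measure ℝ).real s' := fun h μ => measureReal_mono h
  have hH1 : listProd (fun μ : ProbabilityMeasure ℝ => (μ : Measure ℝ).real (Set.Iic t))
      (List.ofFn ν) ≤ 1 :=
    listProd_le_one (fun _ _ => measureReal_nonneg) (hle1 _)
  have hH0 : 0 ≤ listProd (fun μ : ProbabilityMeasure ℝ => (μ : Measure ℝ).real (Set.Iic t))
      (List.ofFn ν) := List.prod_nonneg (by simp)
  rcases lt_or_ge t τ₁ with ht₁ | ht₁
  · have e1 : Set.Ici τ₁ ∩ Set.Ioi t = Set.Ici τ₁ :=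
      Set.inter_eq_left.2 fun x hx => ht₁.trans_le hx
    have e2 : Set.Icc τ₁ t = ∅ := Set.Icc_eq_empty ht₁.not_ge
    simp only [e1, e2, real_Ici_eq, Set.empty_inter, measureReal_empty]
    rw [firstWin_one_sub, h₁]
    have : 0 ≤ 1 - Real.exp (-c₁) := sub_nonneg.2 (Real.exp_le_one_iff.2 (by linarith))
    refine (mul_le_mul_of_nonneg_right hρ₁ (sub_nonneg.2 hH1)).trans ?_
    rw [C₁]
    nlinarith
  have e1 : Set.Ici τ₁ ∩ Set.Ioi t = Set.Ioi t :=
    Set.inter_eq_right.2 fun x hx => ht₁.trans (Set.mem_Ioi.1 hx).le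
  have hf_le : Set.Iio τ₁ ⊆ Set.Iic t := fun x hx => (Set.mem_Iio.1 hx).le.trans ht₁
  have hHpos : 0 < listProd (fun μ : ProbabilityMeasure ℝ => (μ : Measure ℝ).real (Set.Iic t))
      (List.ofFn ν) :=
    listProd_pos fun μ hμ => (hpos μ hμ).trans_le (hmono hf_le μ)
  rcases lt_or_ge t τ₂ with ht₂ | ht₂
  · have e2 : Set.Icc τ₁ t ∩ Set.Iio τ₂ = Set.Icc τ₁ t :=
      Set.inter_eq_left.2 fun x hx => hx.2.trans_lt ht₂
    have e3 : Set.Icc τ₁ t ∩ Set.Ici τ₂ = ∅ :=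
      Set.eq_empty_of_forall_notMem fun x hx => (hx.1.2.trans_lt ht₂).not_ge hx.2
    have e4 : Set.Ici τ₂ ∩ Set.Ioi t = Set.Ici τ₂ :=
      Set.inter_eq_left.2 fun x hx => ht₂.trans_le hx
    simp only [e1, e2, e3, e4, real_Ioi_eq, real_Ici_eq, real_Icc_eq _ ht₁, measureReal_empty]
    have hh_le : Set.Iic t ⊆ Set.Iio τ₂ := fun x hx => (Set.mem_Iic.1 hx).trans_lt ht₂
    have hsub : (laterWin (fun μ : ProbabilityMeasure ℝ =>
      (μ : Measure ℝ).real (Set.Iio τ₂)) (fun μ => 1 - (μ : Measure ℝ).real (Set.Iio τ₂))) =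
        fun l => 1 - listProd (fun μ : ProbabilityMeasure ℝ =>
          (μ : Measure ℝ).real (Set.Iio τ₂)) l := funext fun l => laterWin_one_sub _ l
    rw [hsub]
    refine le_trans ?_ (firstWin_ge_of_low (hmono hf_le) (hmono hh_le) _ hpos)
    rw [h₁, h₂]
    have hp1 : Real.exp (-c₁) < 1 := Real.exp_lt_one_iff.2 (by linarith)
    have hq1 : Real.exp (-c₂) < 1 := Real.exp_lt_one_iff.2 (by linarith)
    rw [C₂_eq_sq (by linarith) (by linarith)] at hρ₂
    have key := (mul_le_mul_of_nonneg_right hρ₂ (sub_nonneg.2 hH1)).trans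
      (sq_mul_one_sub_le _ _ hHpos)
    rw [Real.sq_sqrt (show 0 ≤ Real.exp (-c₁) * Real.exp (-c₂) by positivity),
      Real.sq_sqrt (mul_nonneg (sub_nonneg.2 hp1.le) (sub_nonneg.2 hq1.le))] at key
    linarith
  have e2 : Set.Icc τ₁ t ∩ Set.Iio τ₂ = Set.Ico τ₁ τ₂ := by
    ext x
    simp only [Set.mem_inter_iff, Set.mem_Icc, Set.mem_Iio, Set.mem_Ico]
    exact ⟨fun h => ⟨h.1.1, h.2⟩, fun h => ⟨⟨h.1, h.2.le.trans ht₂⟩, h.2⟩⟩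
  have e3 : Set.Icc τ₁ t ∩ Set.Ici τ₂ = Set.Icc τ₂ t := by
    ext x
    simp only [Set.mem_inter_iff, Set.mem_Icc, Set.mem_Ici]
    exact ⟨fun h => ⟨h.2, h.1.2⟩, fun h => ⟨⟨hτ₁₂.le.trans h.1, h.2⟩, h.1⟩⟩
  have e4 : Set.Ici τ₂ ∩ Set.Ioi t = Set.Ioi t :=
    Set.inter_eq_right.2 fun x hx => ht₂.trans (Set.mem_Ioi.1 hx).le
  simp only [e1, e2, e3, e4, real_Ioi_eq, real_Ico_eq _ hτ₁₂.le, real_Icc_eq _ ht₂]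
  have hg_le : Set.Iio τ₂ ⊆ Set.Iic t := fun x hx => (Set.mem_Iio.1 hx).le.trans ht₂
  have hfg := hmono (Set.Iio_subset_Iio hτ₁₂.le)
  have hgk := hmono (Set.Iio_subset_Iio hτ₂₃)
  rcases lt_or_ge t τ₃ with ht₃ | ht₃
  · have e5 : Set.Ici τ₃ ∩ Set.Ioi t = Set.Ici τ₃ :=
      Set.inter_eq_left.2 fun x hx => ht₃.trans_le hx
    simp only [e5, real_Ici_eq]
    have hsub : (laterWin (fun μ : ProbabilityMeasure ℝ =>
      (μ : Measure ℝ).real (Set.Iio τ₃)) (fun μ => 1 - (μ : Measure ℝ).real (Set.Iio τ₃))) =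
        fun l => 1 - listProd (fun μ : ProbabilityMeasure ℝ =>
          (μ : Measure ℝ).real (Set.Iio τ₃)) l := funext fun l => laterWin_one_sub _ l
    rw [hsub]
    have hh_le : Set.Iic t ⊆ Set.Iio τ₃ := fun x hx => (Set.mem_Iic.1 hx).trans_lt ht₃
    refine le_trans ?_ (firstWin_ge_of_mid hfg (hmono hg_le) (hmono hh_le) (hle1 _) hpos)
    rw [h₁, h₂, h₃]
    have hpq : Real.exp (-c₁) ≤ Real.exp (-c₂) := Real.exp_le_exp.2 (by linarith)
    have hq1 : Real.exp (-c₂) < 1 := Real.exp_lt_one_iff.2 (by linarith)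
    have hk1 : Real.exp (-c₃) < 1 := Real.exp_lt_one_iff.2 (by linarith)
    have hp := Real.exp_pos (-c₁)
    have hq := Real.exp_pos (-c₂)
    have hk := Real.exp_pos (-c₃)
    have hρ := hρ₃ (ht₂.trans_lt ht₃)
    rw [C₃_eq_sq hc₂₁.le (by linarith) hc₃ rfl] at hρ
    have key := (mul_le_mul_of_nonneg_right hρ (sub_nonneg.2 hH1)).trans
      (sq_mul_one_sub_le _ _ hHpos)
    have hm0 : 0 ≤ Real.exp (-c₁) * (1 - Real.exp (-c₃)) / Real.exp (-c₂) :=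
      div_nonneg (mul_nonneg hp.le (by linarith)) hq.le
    have hm1 : Real.exp (-c₁) * (1 - Real.exp (-c₃)) / Real.exp (-c₂) ≤ 1 := by
      rw [div_le_one hq]; nlinarith
    rw [Real.sq_sqrt (mul_nonneg hq.le (by linarith)),
      Real.sq_sqrt (mul_nonneg hm0 (by linarith))] at key
    refine key.trans (le_of_eq ?_)
    field_simp
    ring
  · have e5 : Set.Ici τ₃ ∩ Set.Ioi t = Set.Ioi t :=
      Set.inter_eq_right.2 fun x hx => ht₃.trans (Set.mem_Ioi.1 hx).le
    simp only [e5, real_Ioi_eq]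
    have hk_le : Set.Iio τ₃ ⊆ Set.Iic t := fun x hx => (Set.mem_Iio.1 hx).le.trans ht₃
    refine le_trans ?_ (firstWin_ge_of_high hfg hgk (hmono hk_le) (hle1 _) hpos)
    rw [h₁, h₂, h₃, ← C₄_eq_openBound]
    exact mul_le_mul_of_nonneg_right hρ₄ (sub_nonneg.2 hH1)

end Bounds

/-! ### Numerical evaluation of the two guarantees -/

section Numerics

/-- The remainder constant is `9 / (8! · 8) = 1 / 35840`. -/
lemma abs_exp_sub_le {x : ℝ} (hx : |x| ≤ 1) :
    |Real.exp x - (1 + x + x ^ 2 / 2 + x ^ 3 / 6 + x ^ 4 / 24 + x ^ 5 / 120 + x ^ 6 / 720 +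
      x ^ 7 / 5040)| ≤ |x| ^ 8 * (1 / 35840) := by
  have h := Real.exp_bound hx (n := 8) (by norm_num)
  norm_num [Finset.sum_range_succ, Nat.factorial] at h ⊢
  exact h

/-- The Taylor estimate needs an argument of size at most `1`, so it is applied to `e^{-c/2}`,
bracketed by `a` and `b`, and then squared. -/
lemma exp_neg_mem_Icc {c lo hi a b : ℝ} (hc0 : 0 ≤ c) (hc : c ≤ 2) (ha : 0 ≤ a)
    (hlo : lo ≤ a ^ 2) (hhi : b ^ 2 ≤ hi)
    (hla : a + (c / 2) ^ 8 / 35840 ≤ 1 - c / 2 + (c / 2) ^ 2 / 2 - (c / 2) ^ 3 / 6 +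
      (c / 2) ^ 4 / 24 - (c / 2) ^ 5 / 120 + (c / 2) ^ 6 / 720 - (c / 2) ^ 7 / 5040)
    (hub : 1 - c / 2 + (c / 2) ^ 2 / 2 - (c / 2) ^ 3 / 6 +
      (c / 2) ^ 4 / 24 - (c / 2) ^ 5 / 120 + (c / 2) ^ 6 / 720 - (c / 2) ^ 7 / 5040 +
      (c / 2) ^ 8 / 35840 ≤ b) :
    lo ≤ Real.exp (-c) ∧ Real.exp (-c) ≤ hi := by
  have habs : |-(c / 2)| = c / 2 := by rw [abs_neg, abs_of_nonneg (by linarith)]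
  have h := abs_le.1 (abs_exp_sub_le (x := -(c / 2)) (by rw [habs]; linarith))
  rw [habs] at h
  have e : Real.exp (-c) = Real.exp (-(c / 2)) ^ 2 := by
    rw [← Real.exp_nat_mul]; congr 1; push_cast; ring
  have h1 : a ≤ Real.exp (-(c / 2)) := by nlinarith [h.1]
  have h2 : Real.exp (-(c / 2)) ≤ b := by nlinarith [h.2]
  rw [e]
  exact ⟨hlo.trans (pow_le_pow_left₀ ha h1 2),
    (pow_le_pow_left₀ (Real.exp_pos _).le h2 2).trans hhi⟩

lemma le_add_sqrt_sq {ρ x y a b : ℝ} (ha : 0 ≤ a) (hb : 0 ≤ b) (hx : a ^ 2 ≤ x) (hy : b ^ 2 ≤ y)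
    (h : ρ ≤ (a + b) ^ 2) : ρ ≤ (√x + √y) ^ 2 := by
  have h1 := Real.le_sqrt_of_sq_le hx
  have h2 := Real.le_sqrt_of_sq_le hy
  exact h.trans (pow_le_pow_left₀ (by positivity) (by linarith) 2)

lemma le_ratio₃ : 0.781 ≤ ratio₃ 1.51921 0.380251 0.0386845 := by
  obtain ⟨p1, p2⟩ : 0.21887 ≤ Real.exp (-1.51921) ∧ Real.exp (-1.51921) ≤ 0.21889 :=
    exp_neg_mem_Icc (a := 0.467844) (b := 0.467856) (by norm_num) (by norm_num) (by norm_num)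
      (by norm_num) (by norm_num) (by norm_num) (by norm_num)
  obtain ⟨q1, q2⟩ : 0.683688 ≤ Real.exp (-0.380251) ∧ Real.exp (-0.380251) ≤ 0.683691 :=
    exp_neg_mem_Icc (a := 0.826855) (b := 0.826856) (by norm_num) (by norm_num) (by norm_num)
      (by norm_num) (by norm_num) (by norm_num) (by norm_num)
  obtain ⟨k1, k2⟩ : 0.962052 ≤ Real.exp (-0.0386845) ∧ Real.exp (-0.0386845) ≤ 0.962055 :=
    exp_neg_mem_Icc (a := 0.980843) (b := 0.980844) (by norm_num) (by norm_num) (by norm_num)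
      (by norm_num) (by norm_num) (by norm_num) (by norm_num)
  rw [ratio₃, C₂_eq_sq (by norm_num) (by norm_num),
    C₃_eq_sq (by norm_num) (by norm_num) (by norm_num) rfl, C₄_eq_openBound, C₁, openBound,
    Real.log_exp]
  generalize Real.exp (-1.51921) = p at *
  generalize Real.exp (-0.380251) = q at *
  generalize Real.exp (-0.0386845) = k at *
  have hq : 0 < q := by linarith
  obtain ⟨m1, m2⟩ : 0.012147 ≤ p * (1 - k) / q ∧ p * (1 - k) / q ≤ 0.01215 := by
    rw [le_div_iff₀ hq, div_le_iff₀ hq]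
    constructor <;> nlinarith
  have hpk : 0.3079 ≤ p * k / q := by rw [le_div_iff₀ hq]; nlinarith
  generalize p * (1 - k) / q = m at *
  refine le_min (le_min (by linarith) ?_) (le_min ?_ (by linarith))
  -- `a` and `b` are rounded-down values of the two square roots; likewise below.
  · refine le_add_sqrt_sq (a := 0.38683) (b := 0.49705) (by norm_num) (by norm_num) ?_ ?_
      (by norm_num) <;> nlinarith
  · refine le_add_sqrt_sq (a := 0.82181) (b := 0.06198) (by norm_num) (by norm_num) ?_ ?_
      (by norm_num) <;> nlinarith

lemma le_ratio₂ : 0.776 ≤ ratio₂ 1.49721 0.364197 := by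
  obtain ⟨p1, p2⟩ : 0.22374 ≤ Real.exp (-1.49721) ∧ Real.exp (-1.49721) ≤ 0.22376 :=
    exp_neg_mem_Icc (a := 0.47302) (b := 0.473031) (by norm_num) (by norm_num) (by norm_num)
      (by norm_num) (by norm_num) (by norm_num) (by norm_num)
  obtain ⟨q1, q2⟩ : 0.694752 ≤ Real.exp (-0.364197) ∧ Real.exp (-0.364197) ≤ 0.694756 :=
    exp_neg_mem_Icc (a := 0.833519) (b := 0.83352) (by norm_num) (by norm_num) (by norm_num)
      (by norm_num) (by norm_num) (by norm_num) (by norm_num)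
  rw [ratio₂_eq, C₂_eq_sq (by norm_num) (by norm_num), C₄_eq_openBound, C₁, openBound,
    Real.log_exp]
  generalize Real.exp (-1.49721) = p at *
  generalize Real.exp (-0.364197) = q at *
  have hq : 0 < q := by linarith
  rw [mul_div_cancel_right₀ p hq.ne']
  refine le_min (by linarith) (le_min ?_ (by linarith))
  refine le_add_sqrt_sq (a := 0.39425) (b := 0.48676) (by norm_num) (by norm_num) ?_ ?_
    (by norm_num) <;> nlinarith

end Numerics

/-! ### Transfer to random variables and integration over the level -/

section Instance

variable {Ω : Type*} [MeasurableSpace Ω] {P : Measure Ω} [IsProbabilityMeasure P] {n : ℕ}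
  {X : Fin n → Ω → ℝ}

lemma prophet_le_iff {Ω : Type*} {X : Fin n → Ω → ℝ} (hn : 0 < n) (ω : Ω) (t : ℝ) : prophet X ω ≤ t ↔ ∀ i, X i ω ≤ t := by
  have : Nonempty (Fin n) := ⟨⟨0, hn⟩⟩
  exact ciSup_le_iff (Set.finite_range _).bddAbove

lemma measurable_prophet (hmeas : ∀ i, Measurable (X i)) : Measurable (prophet X) :=
  Measurable.iSup hmeas

/-- The law of `X i`. -/
noncomputable def lawOf (P : Measure Ω) [IsProbabilityMeasure P] {X : Fin n → Ω → ℝ}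
    (hmeas : ∀ i, Measurable (X i)) (i : Fin n) : ProbabilityMeasure ℝ :=
  ⟨P.map (X i), Measure.isProbabilityMeasure_map (hmeas i).aemeasurable⟩

lemma map_eq_law (hmeas : ∀ i, Measurable (X i)) (hindep : iIndepFun X P) :
    P.map (fun ω i => X i ω) = law (lawOf P hmeas) :=
  (iIndepFun_iff_map_fun_eq_pi_map fun i => (hmeas i).aemeasurable).1 hindep

lemma real_preimage_eq_law (hmeas : ∀ i, Measurable (X i)) (hindep : iIndepFun X P)
    {S : Set (Fin n → ℝ)} (hS : MeasurableSet S) :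
    P.real {ω | (fun i => X i ω) ∈ S} = (law (lawOf P hmeas)).real S := by
  rw [← map_eq_law hmeas hindep, map_measureReal_apply (measurable_pi_lambda _ hmeas) hS]
  rfl

lemma real_prophet_le (hn : 0 < n) (hmeas : ∀ i, Measurable (X i)) (hindep : iIndepFun X P)
    (t : ℝ) :
    P.real {ω | prophet X ω ≤ t} =
      listProd (fun μ : ProbabilityMeasure ℝ => (μ : Measure ℝ).real (Set.Iic t))
        (List.ofFn (lawOf P hmeas)) := by
  have e : {ω | prophet X ω ≤ t} =
      {ω | (fun i => X i ω) ∈ Set.univ.pi fun _ : Fin n => Set.Iic t} := by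
    ext ω; simp [prophet_le_iff hn, Set.mem_pi, -Set.pi_univ_Iic]
  rw [e, real_preimage_eq_law hmeas hindep (MeasurableSet.univ_pi fun _ => measurableSet_Iic),
    listProd, List.map_ofFn, List.prod_ofFn, measureReal_def, Measure.pi_pi, ENNReal.toReal_prod]
  rfl

/-- The algorithm skips values `< τ`, whereas quantiles concern values `≤ τ`; the absence of atoms
reconciles the two. -/
lemma lawOf_real_Iio (hmeas : ∀ i, Measurable (X i))
    (hcont : ∀ i, ∀ x : ℝ, P {ω | X i ω = x} = 0) (i : Fin n) (t : ℝ) :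
    (lawOf P hmeas i : Measure ℝ).real (Set.Iio t) =
      (lawOf P hmeas i : Measure ℝ).real (Set.Iic t) := by
  have h0 : (lawOf P hmeas i : Measure ℝ) {t} = 0 := by
    change P.map (X i) {t} = 0
    rw [Measure.map_apply (hmeas i) (measurableSet_singleton t)]
    exact hcont i t
  rw [← Set.Iio_union_right, measureReal_def, measureReal_def,
    measure_congr (union_ae_eq_left_of_ae_eq_empty (ae_eq_empty.2 h0))]

lemma real_prophet_le' (hn : 0 < n) (hmeas : ∀ i, Measurable (X i)) (hindep : iIndepFun X P)
    (hcont : ∀ i, ∀ x : ℝ, P {ω | X i ω = x} = 0) (t : ℝ) :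
    P.real {ω | prophet X ω ≤ t} =
      listProd (fun μ : ProbabilityMeasure ℝ => (μ : Measure ℝ).real (Set.Iio t))
        (List.ofFn (lawOf P hmeas)) := by
  rw [real_prophet_le hn hmeas hindep, listProd, listProd, List.map_ofFn, List.map_ofFn]
  congr 2
  ext i
  exact (lawOf_real_Iio hmeas hcont i t).symm

lemma lt_of_real_prophet_lt {s t : ℝ}
    (h : P.real {ω | prophet X ω ≤ s} < P.real {ω | prophet X ω ≤ t}) : s < t := by
  by_contra! hts
  exact h.not_ge (measureReal_mono fun ω hω => le_trans hω hts)

/-- Quantiles of the maximum exist. -/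
lemma exists_quantile (hn : 0 < n) (hmeas : ∀ i, Measurable (X i))
    (hcont : ∀ i, ∀ x : ℝ, P {ω | X i ω = x} = 0) {c : ℝ} (hc : 0 < c) :
    ∃ τ : ℝ, P.real {ω | prophet X ω ≤ τ} = Real.exp (-c) := by
  have hZ := measurable_prophet hmeas
  have : IsProbabilityMeasure (P.map (prophet X)) :=
    Measure.isProbabilityMeasure_map hZ.aemeasurable
  have : Nonempty (Fin n) := ⟨⟨0, hn⟩⟩
  have hatom : ∀ x, P.map (prophet X) {x} = 0 := by
    intro x
    rw [Measure.map_apply hZ (measurableSet_singleton x)]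
    refine measure_mono_null (t := ⋃ i, {ω | X i ω = x}) (fun ω hω => ?_)
      (measure_iUnion_null fun i => hcont i x)
    obtain ⟨i, hi⟩ := exists_eq_ciSup_of_finite (f := fun i => X i ω)
    exact Set.mem_iUnion.2 ⟨i, hi.trans hω⟩
  -- The cdf is right-continuous and its jump at `x` is the mass of `{x}`, so it is continuous and
  -- the intermediate value theorem yields the quantile.
  have hcdf : Continuous (cdf (P.map (prophet X))) := by
    refine continuous_iff_continuousAt.2 fun x => ?_
    rw [(monotone_cdf _).continuousAt_iff_leftLim_eq_rightLim, StieltjesFunction.rightLim_eq]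
    have h := hatom x
    rw [← measure_cdf (P.map (prophet X)), StieltjesFunction.measure_singleton,
      ENNReal.ofReal_eq_zero] at h
    exact le_antisymm ((monotone_cdf _).leftLim_le le_rfl) (by linarith)
  have hlow : ∃ x, cdf (P.map (prophet X)) x ≤ Real.exp (-c) :=
    ((tendsto_cdf_atBot _).eventually_le_const (Real.exp_pos _)).exists
  have hhigh : ∃ x, Real.exp (-c) ≤ cdf (P.map (prophet X)) x :=
    ((tendsto_cdf_atTop _).eventually_const_le (Real.exp_lt_one_iff.2 (by linarith))).exists
  obtain ⟨x, hx⟩ := hlow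
  obtain ⟨y, hy⟩ := hhigh
  obtain ⟨τ, hτ⟩ := mem_range_of_exists_le_of_exists_ge hcdf ⟨x, hx⟩ ⟨y, hy⟩
  refine ⟨τ, ?_⟩
  rw [← hτ, cdf_eq_real, map_measureReal_apply hZ measurableSet_Iic]
  rfl

/-- A reward whose level sets are the events `Hit` is `ρ`-competitive. -/
lemma mul_expect_prophet_le (hn : 0 < n) (hmeas : ∀ i, Measurable (X i))
    (hnonneg : ∀ i, ∀ᵐ ω ∂P, 0 ≤ X i ω) (hcont : ∀ i, ∀ x : ℝ, P {ω | X i ω = x} = 0)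
    (hindep : iIndepFun X P) {c₁ c₂ c₃ τ₁ τ₂ τ₃ : ℝ}
    (hc₃ : 0 < c₃) (hc₃₂ : c₃ ≤ c₂) (hc₂₁ : c₂ < c₁) (hτ₂₃ : τ₂ ≤ τ₃)
    (h₁ : P.real {ω | prophet X ω ≤ τ₁} = Real.exp (-c₁))
    (h₂ : P.real {ω | prophet X ω ≤ τ₂} = Real.exp (-c₂))
    (h₃ : P.real {ω | prophet X ω ≤ τ₃} = Real.exp (-c₃))
    {alg : (Fin n → ℝ) → ℝ} (halg0 : ∀ x, 0 ≤ alg x)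
    (halg : ∀ t, 0 ≤ t → ∀ x, t < alg x ↔ Hit τ₁ τ₂ τ₃ t (List.ofFn x))
    {ρ : ℝ} (hρ₁ : ρ ≤ C₁ c₁) (hρ₂ : ρ ≤ C₂ c₁ c₂) (hρ₃ : τ₂ < τ₃ → ρ ≤ C₃ c₁ c₂ c₃)
    (hρ₄ : ρ ≤ C₄ c₁ c₂ c₃) :
    ENNReal.ofReal ρ * expect P (prophet X) ≤ expect P (fun ω => alg fun i => X i ω) := by
  have hτ₁₂ : τ₁ < τ₂ := lt_of_real_prophet_lt (P := P) (X := X) <| by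
    rw [h₁, h₂]; exact Real.exp_lt_exp.2 (by linarith)
  have hZ := measurable_prophet hmeas
  have hset : ∀ t, 0 ≤ t → {x : Fin n → ℝ | t < alg x} =
      {x | Hit τ₁ τ₂ τ₃ t (List.ofFn x)} := fun t ht => Set.ext fun x => halg t ht x
  have hmalg : Measurable alg := by
    refine measurable_of_Ioi fun t => ?_
    rcases lt_or_ge t 0 with ht | ht
    · convert MeasurableSet.univ
      exact Set.eq_univ_of_forall fun x => ht.trans_le (halg0 x)
    · change MeasurableSet {x : Fin n → ℝ | t < alg x}
      rw [hset t ht]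
      exact measurableSet_hit n _ _ _ _
  have hX : Measurable fun ω i => X i ω := measurable_pi_lambda _ hmeas
  have hZ0 : 0 ≤ᵐ[P] prophet X := by
    filter_upwards [hnonneg ⟨0, hn⟩] with ω hω
    exact hω.trans ((prophet_le_iff hn ω _).1 le_rfl _)
  unfold expect
  -- Both expectations become integrals of tail probabilities over `t > 0`, to be compared
  -- pointwise.
  rw [lintegral_eq_lintegral_meas_lt P hZ0 hZ.aemeasurable,
    lintegral_eq_lintegral_meas_lt P (Filter.Eventually.of_forall fun ω => halg0 _)
      (hmalg.comp hX).aemeasurable,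
    ← lintegral_const_mul' _ _ ENNReal.ofReal_ne_top]
  refine setLIntegral_mono' measurableSet_Ioi fun t ht => ?_
  have key := mul_one_sub_le_law_hit (lawOf P hmeas) hc₃ hc₃₂ hc₂₁ hτ₁₂ hτ₂₃
    (by rw [← real_prophet_le' hn hmeas hindep hcont, h₁])
    (by rw [← real_prophet_le' hn hmeas hindep hcont, h₂])
    (by rw [← real_prophet_le' hn hmeas hindep hcont, h₃]) hρ₁ hρ₂ hρ₃ hρ₄ t
  rw [← real_prophet_le hn hmeas hindep, ← real_preimage_eq_law hmeas hindep
    (measurableSet_hit n _ _ _ _), ← probReal_compl_eq_one_sub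
    (measurableSet_le hZ measurable_const)] at key
  have hcompl : {ω | prophet X ω ≤ t}ᶜ = {ω | t < prophet X ω} := by ext; simp
  have hhit : {ω | (fun i => X i ω) ∈ {x | Hit τ₁ τ₂ τ₃ t (List.ofFn x)}} =
      {ω | t < alg fun i => X i ω} := by
    rw [← hset t (Set.mem_Ioi.1 ht).le]; rfl
  rw [hcompl, hhit] at key
  have := ENNReal.ofReal_le_ofReal key
  rwa [ENNReal.ofReal_mul' measureReal_nonneg, ofReal_measureReal, ofReal_measureReal] at this

end Instance

end TopOneOfTwo

/-! ### The main theorem -/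

theorem mainTheorem1 {Ω : Type*} [MeasurableSpace Ω] (P : Measure Ω) [IsProbabilityMeasure P]
    {n : ℕ} (hn : 0 < n) (X : Fin n → Ω → ℝ)
    (hmeas : ∀ i, Measurable (X i))
    (hnonneg : ∀ i, ∀ᵐ ω ∂P, 0 ≤ X i ω)
    (hcont : ∀ i, ∀ x : ℝ, P {ω | X i ω = x} = 0)
    (hindep : iIndepFun X P) :
    -- quantile thresholds exist
    (∀ c : ℝ, 0 < c → ∃ τ : ℝ, P.real {ω | TopOneOfTwo.prophet X ω ≤ τ} = Real.exp (-c)) ∧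
    -- the three-threshold algorithm
    (∀ τ : Fin 3 → ℝ,
      TopOneOfTwo.IsQuantileThresholds P X ![1.51921, 0.380251, 0.0386845] τ →
        ENNReal.ofReal (TopOneOfTwo.ratio₃ 1.51921 0.380251 0.0386845)
            * TopOneOfTwo.expect P (TopOneOfTwo.prophet X)
          ≤ TopOneOfTwo.expect P (fun ω => TopOneOfTwo.alg₃ τ (fun i => X i ω)) ∧
        ENNReal.ofReal 0.781 * TopOneOfTwo.expect P (TopOneOfTwo.prophet X)
          ≤ TopOneOfTwo.expect P (fun ω => TopOneOfTwo.alg₃ τ (fun i => X i ω))) ∧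
    0.781 ≤ TopOneOfTwo.ratio₃ 1.51921 0.380251 0.0386845 ∧
    -- the two-threshold algorithm
    (∀ c₁ c₂ : ℝ, 0 < c₂ → c₂ < c₁ → ∀ τ : Fin 2 → ℝ,
      TopOneOfTwo.IsQuantileThresholds P X ![c₁, c₂] τ →
        ENNReal.ofReal (TopOneOfTwo.ratio₂ c₁ c₂) * TopOneOfTwo.expect P (TopOneOfTwo.prophet X)
          ≤ TopOneOfTwo.expect P (fun ω => TopOneOfTwo.alg₂ τ (fun i => X i ω))) ∧
    0.776 ≤ TopOneOfTwo.ratio₂ 1.49721 0.364197 := by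
  have hratio₃ : ∀ τ : Fin 3 → ℝ,
      TopOneOfTwo.IsQuantileThresholds P X ![1.51921, 0.380251, 0.0386845] τ →
        ENNReal.ofReal (TopOneOfTwo.ratio₃ 1.51921 0.380251 0.0386845)
            * TopOneOfTwo.expect P (TopOneOfTwo.prophet X)
          ≤ TopOneOfTwo.expect P (fun ω => TopOneOfTwo.alg₃ τ (fun i => X i ω)) := by
    intro τ hτ
    have h₁ := hτ 0
    have h₂ := hτ 1
    have h₃ := hτ 2
    simp only [Matrix.cons_val] at h₁ h₂ h₃
    have h₂₃ : τ 1 < τ 2 := TopOneOfTwo.lt_of_real_prophet_lt (P := P) (X := X) <| by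
      rw [h₂, h₃]; exact Real.exp_lt_exp.2 (by norm_num)
    exact TopOneOfTwo.mul_expect_prophet_le hn hmeas hnonneg hcont hindep
      (by norm_num) (by norm_num) (by norm_num) h₂₃.le h₁ h₂ h₃
      (fun _ => TopOneOfTwo.reward_nonneg _) (fun t ht x => TopOneOfTwo.lt_alg₃ ht x)
      ((min_le_left _ _).trans (min_le_left _ _)) ((min_le_left _ _).trans (min_le_right _ _))
      (fun _ => (min_le_right _ _).trans (min_le_left _ _))
      ((min_le_right _ _).trans (min_le_right _ _))
  refine ⟨fun c hc => TopOneOfTwo.exists_quantile hn hmeas hcont hc,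
    fun τ hτ => ⟨hratio₃ τ hτ, le_trans ?_ (hratio₃ τ hτ)⟩, TopOneOfTwo.le_ratio₃, ?_,
    TopOneOfTwo.le_ratio₂⟩
  · gcongr
    exact TopOneOfTwo.le_ratio₃
  · intro c₁ c₂ hc₂ hc τ hτ
    have h₁ := hτ 0
    have h₂ := hτ 1
    simp only [Matrix.cons_val] at h₁ h₂
    rw [TopOneOfTwo.ratio₂_eq]
    -- Here `τ₃ = τ₂` and `c₃ = c₂`; no level lies in `[τ₂, τ₃)`, so the condition on `C₃` is void.
    exact TopOneOfTwo.mul_expect_prophet_le hn hmeas hnonneg hcont hindep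
      hc₂ le_rfl hc le_rfl h₁ h₂ h₂
      (fun _ => TopOneOfTwo.reward_nonneg _) (fun t ht x => TopOneOfTwo.lt_alg₂ ht x)
      (min_le_left _ _) ((min_le_right _ _).trans (min_le_left _ _))
      (fun h => absurd h (lt_irrefl _)) ((min_le_right _ _).trans (min_le_right _ _))
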